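/- For complex $q$ and an integer $n\ge 0$ put $(a)_n=(a;q)_n=\prod_{i=0}^{n-1}(1-aq^i)$. For every complex number $q$ with $|q|<1$, the three series below converge absolutely and $$\sum_{n=1}^{\infty}\frac{(-q)_n}{(q)_n}\frac{q^n}{1-q^n}-2\sum_{n=1}^{\infty}\frac{(-q)_{n-1}}{(q)_n^{2}}\frac{q^{n(n+3)/2}}{1-q^n}=\sum_{n=1}^{\infty}\frac{q^n}{1-q^n}.$$ Moreover, for every integer $n\ge 1$, $$\sum_{\substack{\pi\in\mathcal{P}_{o}(n)\\ l(\pi)\ \text{overlined}}}\bigl(2L(\pi)-1\bigr)-\sum_{\substack{\pi\in\mathcal{P}^{*}(n)\\ L(\pi)\ge 2}}L(\pi)\bigl(L(\pi)-1\bigr)\prod_{i=1}^{l(\pi)-1}\bigl(2\nu(i)-1\bigr)=d(n).$$ Here $d(n)$ is the number of positive divisors of $n$; $\mathcal{P}_o(n)$ is the set of overpartitions of $n$, that is, partitions of $n$ in which the first occurrence of each part size may be overlined; $\mathcal{P}^*(n)$ is the set of partitions of $n$ without gaps, that is, those in which every integer from $1$ to the largest part occurs as a part; $l(\pi)$ is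 the largest part of $\pi$, $L(\pi)$ is the total number of appearances of the largest part (overlined or not), and $\nu(i)=\nu_\pi(i)$ is the number of appearances of $i$ in $\pi$. The condition "$l(\pi)$ overlined" means that the first occurrence of the largest part is overlined. -/

import Mathlib

namespace QDivisor

/-- The `q`-shifted factorial `(a; q)_n = (1 - a)(1 - a q) ⋯ (1 - a q ^ (n - 1))`, with
`(a; q)_0 = 1`. -/
def qPoch (a q : ℂ) (n : ℕ) : ℂ :=
  ∏ i ∈ Finset.range n, (1 - a * q ^ i)

/-- The largest part `l(π)` of a partition (`0` for the empty partition). -/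
def largestPart {n : ℕ} (π : n.Partition) : ℕ :=
  π.parts.sup

/-- The number of appearances `ν(i)` of `i` as a part of a partition. -/
def mult {n : ℕ} (π : n.Partition) (i : ℕ) : ℕ :=
  π.parts.count i

/-- The total number of appearances `L(π)` of the largest part of a partition. -/
def largestMult {n : ℕ} (π : n.Partition) : ℕ :=
  mult π (largestPart π)

/-- A partition is without gaps if every integer from `1` to its largest part is a part. -/
def GapFree {n : ℕ} (π : n.Partition) : Prop :=
  ∀ i ∈ Finset.Icc 1 (largestPart π), i ∈ π.parts

instance {n : ℕ} : DecidablePred (GapFree (n := n)) := fun π =>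
  inferInstanceAs (Decidable (∀ i ∈ Finset.Icc 1 (largestPart π), i ∈ π.parts))

/-- An overpartition of `n`: a partition of `n` in which the first occurrence of each part size
may be overlined. It is recorded as the underlying partition (overlines forgotten) together with
the set of those part sizes whose first occurrence is overlined. -/
@[ext]
structure Overpartition (n : ℕ) where
  /-- the underlying partition, with overlined and non-overlined parts together -/
  partition : n.Partition
  /-- the part sizes whose first occurrence is overlined -/
  overlined : Finset ℕ
  overlined_subset : overlined ⊆ partition.parts.toFinset

/-- Overpartitions as pairs of a partition and a subset of its set of part sizes. -/
def overpartitionEquiv (n : ℕ) :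
    (Σ π : n.Partition, {S : Finset ℕ // S ∈ π.parts.toFinset.powerset}) ≃ Overpartition n where
  toFun x := ⟨x.1, x.2.1, Finset.mem_powerset.mp x.2.2⟩
  invFun x := ⟨x.partition, x.overlined, Finset.mem_powerset.mpr x.overlined_subset⟩
  left_inv _ := rfl
  right_inv _ := rfl

instance (n : ℕ) : Fintype (Overpartition n) :=
  Fintype.ofEquiv _ (overpartitionEquiv n)

end QDivisor

/-!
The analytic and the combinatorial identity are two readings of one finite identity, valid for any
parameter `b` in a commutative ring in which the `1 - q^i` are invertible. The `q`-Chu–Vandermonde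
identity (`prod_one_sub_mul_prod_eq_sum`) expands `(b; q)_n / (q; q)_n` as `∑ₖ [n, k]_q c_k`, where
`c_k = ∏_{i=1}^{k} q^{i-1} (q^i - b) / (1 - q^i)` does not depend on `n`. Multiplying by
`q^n / (1 - q^n)` and summing over `n ≤ N`, the term `k = 0` gives `∑ q^n / (1 - q^n)`, and for
`k ≥ 1` the sum over `n` closes up to `[N, k]_q q^k / (1 - q^k)`; this is
`sum_qPochhammer_ratio_eq`. At `b = -q` one has `∏_{i=1}^{k} (q^i - b) = 2 q^k (-q; q)_{k-1}`.

For complex `|q| < 1`, the Gaussian binomials tend to `1 / (q; q)_k` as `N → ∞` and are bounded by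
a multiple of it (`norm_gaussBinom_le`), so dominated convergence gives the first identity.

For the second identity the ring is `ℤ⟦X⟧` with `q = X` and `N = n`. The difference between
`[n, k]` and its limit does not affect the coefficient of `X^n` (`coeff_gaussBinom_mul`), and this
coefficient is read off as a sum over partitions of `n`, sorted by the largest part
(`sum_coeff_prod_multSeries_mul`). There the weights come from
`∑ (2 c - 1) x^c = x (1 + x) / (1 - x)^2`, `∑ c (c - 1) x^c = 2 x^2 / (1 - x)^3` and, for the choice
of overlines, `1 + ∑ 2 x^c = (1 + x) / (1 - x)`.
-/

namespace QDivisor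

/-! ### Gaussian binomials and the finite identity -/

section FiniteIdentity

variable {R : Type*} [CommRing R]

/-- The Gaussian binomial coefficient `[n, k]_q`, through its `q`-Pascal recursion. The truncated
exponent `n - k` is harmless: it only meets factors `[n, k]_q` with `k > n`, which vanish. -/
def gaussBinom (q : R) : ℕ → ℕ → R
  | _, 0 => 1
  | 0, _ + 1 => 0
  | n + 1, k + 1 => gaussBinom q n (k + 1) + q ^ (n - k) * gaussBinom q n k

@[simp]
lemma gaussBinom_zero_right (q : R) (n : ℕ) : gaussBinom q n 0 = 1 := by
  cases n <;> rfl

@[simp]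
lemma gaussBinom_zero_succ (q : R) (k : ℕ) : gaussBinom q 0 (k + 1) = 0 := rfl

lemma gaussBinom_succ_succ (q : R) (n k : ℕ) :
    gaussBinom q (n + 1) (k + 1) = gaussBinom q n (k + 1) + q ^ (n - k) * gaussBinom q n k := rfl

lemma gaussBinom_eq_zero_of_lt (q : R) {n k : ℕ} (h : n < k) : gaussBinom q n k = 0 := by
  induction n generalizing k with
  | zero => obtain ⟨k, rfl⟩ := Nat.exists_eq_add_one_of_ne_zero h.ne'; rfl
  | succ n ih =>
    obtain ⟨k, rfl⟩ := Nat.exists_eq_add_one_of_ne_zero (Nat.ne_zero_of_lt h)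
    rw [gaussBinom_succ_succ, ih (by omega), ih (by omega), mul_zero, add_zero]

lemma one_sub_pow_mul_gaussBinom_succ_right (q : R) (n k : ℕ) :
    (1 - q ^ (k + 1)) * gaussBinom q n (k + 1) = (1 - q ^ (n - k)) * gaussBinom q n k := by
  induction n generalizing k with
  | zero => simp
  | succ n ih =>
    rcases lt_trichotomy k (n + 1) with hk | rfl | hk
    · have h1 := ih k
      obtain ⟨d, rfl⟩ : ∃ d, n = k + d := ⟨n - k, by omega⟩
      cases k with
      | zero =>
        simp only [gaussBinom_succ_succ, gaussBinom_zero_right] at h1 ⊢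
        simp only [zero_add, tsub_zero] at h1 ⊢
        linear_combination h1
      | succ j =>
        have h2 := ih j
        simp only [gaussBinom_succ_succ] at h1 h2 ⊢
        rw [show j + 1 + d - j = d + 1 by omega] at h2 ⊢
        rw [show j + 1 + d - (j + 1) = d by omega] at h1 ⊢
        rw [show j + 1 + d + 1 - (j + 1) = d + 1 by omega]
        linear_combination h1 + q ^ (d + 1) * h2
    · rw [gaussBinom_eq_zero_of_lt q (by omega)]; simp
    · rw [gaussBinom_eq_zero_of_lt q (by omega), gaussBinom_eq_zero_of_lt q hk]; simp

lemma one_sub_pow_mul_gaussBinom_succ_succ (q : R) (n k : ℕ) :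
    (1 - q ^ (k + 1)) * gaussBinom q (n + 1) (k + 1) = (1 - q ^ (n + 1)) * gaussBinom q n k := by
  rcases le_or_gt k n with hk | hk
  · have h := one_sub_pow_mul_gaussBinom_succ_right q n k
    obtain ⟨d, rfl⟩ : ∃ d, n = k + d := ⟨n - k, by omega⟩
    rw [gaussBinom_succ_succ]
    rw [show k + d - k = d by omega] at h ⊢
    linear_combination h
  · rw [gaussBinom_eq_zero_of_lt q (by omega), gaussBinom_eq_zero_of_lt q hk]; simp

lemma gaussBinom_eq_prod_mul {q : R} {u : ℕ → R} (hu : ∀ i, (1 - q ^ (i + 1)) * u (i + 1) = 1)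
    (n k : ℕ) : gaussBinom q n k =
      (∏ i ∈ Finset.range k, (1 - q ^ (n - i))) * ∏ i ∈ Finset.range k, u (i + 1) := by
  induction k with
  | zero => simp
  | succ k ih =>
    rw [Finset.prod_range_succ, Finset.prod_range_succ]
    linear_combination (1 - q ^ (n - k)) * u (k + 1) * ih - gaussBinom q n (k + 1) * hu k
      + u (k + 1) * one_sub_pow_mul_gaussBinom_succ_right q n k

/-- The coefficient `∏_{i=1}^{k} q^{i-1} (q^i - b) / (1 - q^i)` of `[n, k]_q` in the expansion of
`(b; q)_n / (q; q)_n`; the function `u` stands for the inverses `i ↦ (1 - q^i)⁻¹`. -/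
def vandermondeCoeff (q b : R) (u : ℕ → R) (k : ℕ) : R :=
  ∏ i ∈ Finset.range k, q ^ i * (q ^ (i + 1) - b) * u (i + 1)

lemma vandermondeCoeff_succ (q b : R) (u : ℕ → R) (k : ℕ) :
    vandermondeCoeff q b u (k + 1) =
      vandermondeCoeff q b u k * (q ^ k * (q ^ (k + 1) - b) * u (k + 1)) :=
  Finset.prod_range_succ _ _

/-- A form of the `q`-Chu–Vandermonde identity:
`(b; q)_n / (q; q)_n = ∑ₖ [n, k]_q ∏_{i=1}^{k} q^{i-1} (q^i - b) / (1 - q^i)`. -/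
lemma prod_one_sub_mul_prod_eq_sum {q : R} (b : R) {u : ℕ → R}
    (hu : ∀ i, (1 - q ^ (i + 1)) * u (i + 1) = 1) (n : ℕ) :
    (∏ i ∈ Finset.range n, (1 - b * q ^ i)) * ∏ i ∈ Finset.range n, u (i + 1) =
      ∑ k ∈ Finset.range (n + 1), gaussBinom q n k * vandermondeCoeff q b u k := by
  induction n with
  | zero => simp [vandermondeCoeff]
  | succ n ih =>
    have hc (k : ℕ) : (1 - q ^ (k + 1)) * vandermondeCoeff q b u (k + 1) =
        q ^ k * (q ^ (k + 1) - b) * vandermondeCoeff q b u k := by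
      rw [vandermondeCoeff_succ]
      linear_combination vandermondeCoeff q b u k * q ^ k * (q ^ (k + 1) - b) * hu k
    have key : (1 - q ^ (n + 1)) *
        ∑ k ∈ Finset.range (n + 2), gaussBinom q (n + 1) k * vandermondeCoeff q b u k =
        (1 - b * q ^ n) *
        ∑ k ∈ Finset.range (n + 1), gaussBinom q n k * vandermondeCoeff q b u k := by
      -- After Pascal's rule on the left, the two sides agree termwise up to the telescoping
      -- difference of `q ^ (n + 1) * (1 - q ^ k) * [n, k] * c k`, which vanishes at both ends.
      have hterm (k : ℕ) (hk : k ∈ Finset.range (n + 1)) :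
          (1 - b * q ^ n) * (gaussBinom q n k * vandermondeCoeff q b u k) =
          (1 - q ^ (n + 1)) * (gaussBinom q n k * vandermondeCoeff q b u k) +
          ((q ^ (n + 1) * (1 - q ^ k) * gaussBinom q n k * vandermondeCoeff q b u k -
            q ^ (n + 1) * (1 - q ^ (k + 1)) * gaussBinom q n (k + 1)
              * vandermondeCoeff q b u (k + 1)) +
          (1 - q ^ (n + 1)) * (q ^ (n - k) * gaussBinom q n k
              * vandermondeCoeff q b u (k + 1))) := by
        have h1 := one_sub_pow_mul_gaussBinom_succ_right q n k
        have h2 := hc k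
        obtain ⟨d, rfl⟩ : ∃ d, n = k + d :=
          ⟨n - k, by have := Finset.mem_range.mp hk; omega⟩
        rw [show k + d - k = d by omega] at h1 ⊢
        linear_combination q ^ (k + d + 1) * vandermondeCoeff q b u (k + 1) * h1
          - q ^ d * gaussBinom q (k + d) k * h2
      rw [Finset.mul_sum (Finset.range (n + 1)), Finset.sum_congr rfl hterm,
        Finset.sum_add_distrib, Finset.sum_add_distrib, Finset.sum_range_sub',
        gaussBinom_eq_zero_of_lt q (Nat.lt_succ_self n), Finset.sum_range_succ' _ (n + 1)]
      simp only [gaussBinom_succ_succ, add_mul, Finset.sum_add_distrib, gaussBinom_zero_right]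
      rw [Finset.sum_range_succ (fun k => gaussBinom q n (k + 1) * vandermondeCoeff q b u (k + 1)),
        gaussBinom_eq_zero_of_lt q (Nat.lt_succ_self n),
        Finset.sum_range_succ' (fun k => (1 - q ^ (n + 1)) *
          (gaussBinom q n k * vandermondeCoeff q b u k)), ← Finset.mul_sum, ← Finset.mul_sum]
      simp only [gaussBinom_zero_right]
      ring
    rw [Finset.prod_range_succ, Finset.prod_range_succ]
    linear_combination (1 - b * q ^ n) * u (n + 1) * ih - u (n + 1) * key
      + (∑ k ∈ Finset.range (n + 2), gaussBinom q (n + 1) k * vandermondeCoeff q b u k) * hu n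

/-- The finite form of the identity, with the Gaussian binomial `[N, k]_q` in the place of its
limit `1 / (q; q)_k`. -/
theorem sum_qPochhammer_ratio_eq {q : R} (b : R) {u : ℕ → R}
    (hu : ∀ i, (1 - q ^ (i + 1)) * u (i + 1) = 1) (N : ℕ) :
    ∑ n ∈ Finset.range N, (∏ i ∈ Finset.range (n + 1), (1 - b * q ^ i)) *
        (∏ i ∈ Finset.range (n + 1), u (i + 1)) * (q ^ (n + 1) * u (n + 1)) =
      ∑ n ∈ Finset.range N, q ^ (n + 1) * u (n + 1) +
      ∑ k ∈ Finset.range N,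
        gaussBinom q N (k + 1) * (q ^ (k + 1) * u (k + 1) * vandermondeCoeff q b u (k + 1)) := by
  induction N with
  | zero => simp
  | succ N ih =>
    -- The increment in `N` of the last sum is summed by the `q`-Chu–Vandermonde expansion.
    have hterm (k : ℕ) (hk : k ∈ Finset.range (N + 1)) :
        gaussBinom q (N + 1) (k + 1) *
          (q ^ (k + 1) * u (k + 1) * vandermondeCoeff q b u (k + 1)) =
        gaussBinom q N (k + 1) * (q ^ (k + 1) * u (k + 1) * vandermondeCoeff q b u (k + 1)) +
        q ^ (N + 1) * u (N + 1) *
          (gaussBinom q (N + 1) (k + 1) * vandermondeCoeff q b u (k + 1)) := by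
      have h1 := one_sub_pow_mul_gaussBinom_succ_succ q N k
      have h2 := gaussBinom_succ_succ q N k
      have h3 := hu k
      have h4 := hu N
      obtain ⟨d, rfl⟩ : ∃ d, N = k + d :=
        ⟨N - k, by have := Finset.mem_range.mp hk; omega⟩
      rw [show k + d - k = d by omega] at h2
      linear_combination (vandermondeCoeff q b u (k + 1) * q ^ (k + 1) * u (k + 1)) * h2
        - (vandermondeCoeff q b u (k + 1) * q ^ (k + d + 1) * u (k + 1)
            * u (k + d + 1)) * h1
        - (vandermondeCoeff q b u (k + 1) * q ^ (k + d + 1) * u (k + 1)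
            * gaussBinom q (k + d) k) * h4
        + (vandermondeCoeff q b u (k + 1) * q ^ (k + d + 1) * u (k + d + 1)
            * gaussBinom q (k + d + 1) (k + 1)) * h3
    rw [Finset.sum_range_succ, ih, Finset.sum_congr rfl hterm, Finset.sum_add_distrib,
      ← Finset.mul_sum, prod_one_sub_mul_prod_eq_sum b hu, Finset.sum_range_succ' _ (N + 1),
      Finset.sum_range_succ (fun n => q ^ (n + 1) * u (n + 1)) N,
      Finset.sum_range_succ (fun k => gaussBinom q N (k + 1) * _),
      gaussBinom_eq_zero_of_lt q (Nat.lt_succ_self N)]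
    simp only [gaussBinom_zero_right, vandermondeCoeff, Finset.range_zero, Finset.prod_empty]
    ring

/-- At `b = -q` the product `∏_{i=1}^{k} (q^i - b)` is `2 q^k (-q; q)_{k-1}`. -/
lemma vandermondeCoeff_neg_self_succ (q : R) (u : ℕ → R) (k : ℕ) :
    vandermondeCoeff q (-q) u (k + 1) =
      2 * ((∏ i ∈ Finset.range (k + 1), q ^ i) * q ^ (k + 1) *
        (∏ i ∈ Finset.range k, (1 + q ^ (i + 1))) * ∏ i ∈ Finset.range (k + 1), u (i + 1)) := by
  simp only [vandermondeCoeff, Finset.prod_mul_distrib]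
  have h : ∏ i ∈ Finset.range (k + 1), (q ^ (i + 1) - -q) =
      2 * (q ^ (k + 1) * ∏ i ∈ Finset.range k, (1 + q ^ (i + 1))) := by
    induction k with
    | zero => simp; ring
    | succ k ih => rw [Finset.prod_range_succ, ih, Finset.prod_range_succ]; ring
  rw [h]
  ring

end FiniteIdentity

/-! ### The limit in the complex unit disc -/

section Analysis

open Filter Topology

lemma one_sub_pow_succ_ne_zero {q : ℂ} (hq : ‖q‖ < 1) (i : ℕ) : 1 - q ^ (i + 1) ≠ 0 := by
  intro h
  have h1 : ‖q ^ (i + 1)‖ = 1 := by rw [← sub_eq_zero.mp h, norm_one]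
  rw [norm_pow] at h1
  exact (pow_lt_one₀ (norm_nonneg q) hq (Nat.succ_ne_zero i)).ne h1

/-- The ratio test in the form `a (n + 1) = ρ n * a n`, which allows vanishing terms. -/
lemma summable_of_succ_eq_mul {a ρ : ℕ → ℂ} {l : ℂ} (h : ∀ n, a (n + 1) = ρ n * a n)
    (hρ : Tendsto ρ atTop (𝓝 l)) (hl : ‖l‖ < 1) : Summable a := by
  obtain ⟨r, hr1, hr2⟩ := exists_between hl
  refine summable_of_ratio_norm_eventually_le (r := r) hr2 ?_
  filter_upwards [hρ.norm.eventually (gt_mem_nhds hr1)] with n hn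
  rw [h, norm_mul]
  exact mul_le_mul_of_nonneg_right hn.le (norm_nonneg _)

variable {q : ℂ}

lemma tendsto_pow_add_zero (hq : ‖q‖ < 1) (m : ℕ) :
    Tendsto (fun n : ℕ => q ^ (n + m)) atTop (𝓝 0) :=
  (tendsto_add_atTop_iff_nat m).mpr (tendsto_pow_atTop_nhds_zero_of_norm_lt_one hq)

lemma tendsto_inv_one_sub_pow_add (hq : ‖q‖ < 1) (m : ℕ) :
    Tendsto (fun n : ℕ => (1 - q ^ (n + m))⁻¹) atTop (𝓝 1) := by
  simpa using ((tendsto_pow_add_zero hq m).const_sub 1).inv₀ (by simp)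

lemma summable_pow_mul_inv_one_sub_pow (hq : ‖q‖ < 1) :
    Summable fun n : ℕ => q ^ (n + 1) * (1 - q ^ (n + 1))⁻¹ := by
  refine summable_of_succ_eq_mul
    (ρ := fun n => q * ((1 - q ^ (n + 1)) * (1 - q ^ (n + 2))⁻¹)) (l := q) (fun n => ?_) ?_ hq
  · have := one_sub_pow_succ_ne_zero hq n
    field_simp
    ring
  · simpa using (((tendsto_pow_add_zero hq 1).const_sub 1).mul
      (tendsto_inv_one_sub_pow_add hq 2)).const_mul q

lemma summable_qPochhammer_ratio (hq : ‖q‖ < 1) (b : ℂ) :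
    Summable fun n : ℕ => (∏ i ∈ Finset.range (n + 1), (1 - b * q ^ i)) *
      (∏ i ∈ Finset.range (n + 1), (1 - q ^ (i + 1))⁻¹) *
      (q ^ (n + 1) * (1 - q ^ (n + 1))⁻¹) := by
  refine summable_of_succ_eq_mul
    (ρ := fun n => q * ((1 - b * q ^ (n + 1)) * (1 - q ^ (n + 2))⁻¹ *
      ((1 - q ^ (n + 1)) * (1 - q ^ (n + 2))⁻¹))) (l := q) (fun n => ?_) ?_ hq
  · rw [Finset.prod_range_succ _ (n + 1), Finset.prod_range_succ _ (n + 1)]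
    have := one_sub_pow_succ_ne_zero hq n
    field_simp
    ring
  · have h := (((tendsto_pow_add_zero hq 1).const_mul b).const_sub 1).mul
      (tendsto_inv_one_sub_pow_add hq 2)
    simpa using (h.mul (((tendsto_pow_add_zero hq 1).const_sub 1).mul
      (tendsto_inv_one_sub_pow_add hq 2))).const_mul q

lemma summable_prod_inv_mul_vandermondeCoeff (hq : ‖q‖ < 1) (b : ℂ) :
    Summable fun k : ℕ => (∏ i ∈ Finset.range (k + 1), (1 - q ^ (i + 1))⁻¹) *
      (q ^ (k + 1) * (1 - q ^ (k + 1))⁻¹ *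
        vandermondeCoeff q b (fun i => (1 - q ^ i)⁻¹) (k + 1)) := by
  refine summable_of_succ_eq_mul
    (ρ := fun k => q * ((1 - q ^ (k + 1)) * (1 - q ^ (k + 2))⁻¹ * (1 - q ^ (k + 2))⁻¹ *
      (q ^ (k + 1) * (q ^ (k + 2) - b) * (1 - q ^ (k + 2))⁻¹))) (l := 0) (fun k => ?_) ?_ (by simp)
  · rw [vandermondeCoeff_succ q b _ (k + 1),
      Finset.prod_range_succ _ (k + 1)]
    have := one_sub_pow_succ_ne_zero hq k
    field_simp
    ring
  · have h := ((tendsto_pow_add_zero hq 1).mul ((tendsto_pow_add_zero hq 2).sub_const b)).mul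
      (tendsto_inv_one_sub_pow_add hq 2)
    simpa using (((((tendsto_pow_add_zero hq 1).const_sub 1).mul
      (tendsto_inv_one_sub_pow_add hq 2)).mul (tendsto_inv_one_sub_pow_add hq 2)).mul h).const_mul q

/-- The limit of `[N, k]_q` as `N → ∞` is `1 / (q; q)_k`. -/
lemma tendsto_gaussBinom (hq : ‖q‖ < 1) (k : ℕ) :
    Tendsto (fun N => gaussBinom q N k) atTop
      (𝓝 (∏ i ∈ Finset.range k, (1 - q ^ (i + 1))⁻¹)) := by
  have h : Tendsto (fun N : ℕ => ∏ i ∈ Finset.range k, (1 - q ^ (N - i))) atTop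
      (𝓝 (∏ i ∈ Finset.range k, (1 - 0 : ℂ))) :=
    tendsto_finsetProd _ fun i _ => ((tendsto_pow_atTop_nhds_zero_of_norm_lt_one hq).comp
      (tendsto_sub_atTop_nat i)).const_sub 1
  simpa [gaussBinom_eq_prod_mul (u := fun i => (1 - q ^ i)⁻¹)
    (fun i => mul_inv_cancel₀ (one_sub_pow_succ_ne_zero hq i))] using
    h.mul_const (∏ i ∈ Finset.range k, (1 - q ^ (i + 1))⁻¹)

/-- The numerator `∏_{i<k} (1 - q^{N-i})` of the Gaussian binomial is bounded uniformly in `N`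
and `k`. -/
lemma norm_gaussBinom_le (hq : ‖q‖ < 1) (N k : ℕ) :
    ‖gaussBinom q N k‖ ≤
      Real.exp (1 - ‖q‖)⁻¹ * ‖∏ i ∈ Finset.range k, (1 - q ^ (i + 1))⁻¹‖ := by
  rcases lt_or_ge N k with h | h
  · rw [gaussBinom_eq_zero_of_lt q h, norm_zero]; positivity
  rw [gaussBinom_eq_prod_mul (u := fun i => (1 - q ^ i)⁻¹)
    (fun i => mul_inv_cancel₀ (one_sub_pow_succ_ne_zero hq i)), norm_mul]
  refine mul_le_mul_of_nonneg_right ?_ (norm_nonneg _)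
  calc ‖∏ i ∈ Finset.range k, (1 - q ^ (N - i))‖
      ≤ ∏ i ∈ Finset.range k, Real.exp (‖q‖ ^ (N - i)) := by
        rw [norm_prod]
        refine Finset.prod_le_prod (fun _ _ => norm_nonneg _) fun i _ => ?_
        calc ‖1 - q ^ (N - i)‖ ≤ ‖(1 : ℂ)‖ + ‖q ^ (N - i)‖ := norm_sub_le _ _
          _ = ‖q‖ ^ (N - i) + 1 := by rw [norm_one, norm_pow, add_comm]
          _ ≤ _ := Real.add_one_le_exp _
    _ = Real.exp (∑ i ∈ Finset.range k, ‖q‖ ^ (N - i)) := (Real.exp_sum _ _).symm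
    _ ≤ Real.exp (1 - ‖q‖)⁻¹ := by
        refine Real.exp_le_exp.mpr ?_
        rw [← tsum_geometric_of_lt_one (norm_nonneg q) hq,
          ← Finset.sum_image (f := fun j => ‖q‖ ^ j) (g := fun i => N - i)
            (s := Finset.range k) (fun i hi j hj hij => by
              simp only [Finset.coe_range, Set.mem_Iio] at hi hj hij
              omega)]
        exact (summable_geometric_of_lt_one (norm_nonneg q) hq).sum_le_tsum _
          fun _ _ => by positivity

/-- The identity with a free parameter `b`, whose product `∏_{i=1}^{k} (q^i - b)` is contained in
`vandermondeCoeff`: the limit of `sum_qPochhammer_ratio_eq` by dominated convergence. -/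
theorem tsum_qPochhammer_ratio_eq (hq : ‖q‖ < 1) (b : ℂ) :
    ∑' n : ℕ, (∏ i ∈ Finset.range (n + 1), (1 - b * q ^ i)) *
      (∏ i ∈ Finset.range (n + 1), (1 - q ^ (i + 1))⁻¹) *
      (q ^ (n + 1) * (1 - q ^ (n + 1))⁻¹) =
    ∑' n : ℕ, q ^ (n + 1) * (1 - q ^ (n + 1))⁻¹ +
    ∑' k : ℕ, (∏ i ∈ Finset.range (k + 1), (1 - q ^ (i + 1))⁻¹) *
      (q ^ (k + 1) * (1 - q ^ (k + 1))⁻¹ *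
        vandermondeCoeff q b (fun i => (1 - q ^ i)⁻¹) (k + 1)) := by
  have hlim : Tendsto (fun N => ∑' k, gaussBinom q N (k + 1) *
      (q ^ (k + 1) * (1 - q ^ (k + 1))⁻¹ *
        vandermondeCoeff q b (fun i => (1 - q ^ i)⁻¹) (k + 1))) atTop
      (𝓝 (∑' k : ℕ, (∏ i ∈ Finset.range (k + 1), (1 - q ^ (i + 1))⁻¹) *
      (q ^ (k + 1) * (1 - q ^ (k + 1))⁻¹ *
        vandermondeCoeff q b (fun i => (1 - q ^ i)⁻¹) (k + 1)))) := by
    refine tendsto_tsum_of_dominated_convergence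
      ((summable_prod_inv_mul_vandermondeCoeff hq b).norm.mul_left (Real.exp (1 - ‖q‖)⁻¹))
      (fun k => (tendsto_gaussBinom hq (k + 1)).mul_const _)
      (Eventually.of_forall fun N k => ?_)
    rw [norm_mul, norm_mul (∏ i ∈ Finset.range (k + 1), _), ← mul_assoc]
    exact mul_le_mul_of_nonneg_right (norm_gaussBinom_le hq N (k + 1)) (norm_nonneg _)
  refine tendsto_nhds_unique (summable_qPochhammer_ratio hq b).hasSum.tendsto_sum_nat
    (((summable_pow_mul_inv_one_sub_pow hq).hasSum.tendsto_sum_nat.add hlim).congr fun N => ?_)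
  rw [tsum_eq_sum (s := Finset.range N) fun k hk => by
    rw [gaussBinom_eq_zero_of_lt q (by simpa using hk), zero_mul]]
  exact (sum_qPochhammer_ratio_eq b (u := fun i => (1 - q ^ i)⁻¹)
    (fun i => mul_inv_cancel₀ (one_sub_pow_succ_ne_zero hq i)) N).symm

lemma prod_range_pow_mul_pow (q : ℂ) (k : ℕ) :
    (∏ i ∈ Finset.range (k + 1), q ^ i) * q ^ (k + 1) * q ^ (k + 1) =
      q ^ ((k + 1) * (k + 1 + 3) / 2) := by
  have h : (∑ i ∈ Finset.range (k + 1), i) + (k + 1) + (k + 1) = (k + 1) * (k + 1 + 3) / 2 := by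
    have := Finset.sum_range_id_mul_two (k + 1)
    rw [Nat.add_sub_cancel] at this
    have h2 : (k + 1) * (k + 1 + 3) =
      ((∑ i ∈ Finset.range (k + 1), i) + (k + 1) + (k + 1)) * 2 := by linarith
    rw [h2, Nat.mul_div_cancel _ two_pos]
  rw [Finset.prod_pow_eq_pow_sum, ← pow_add, ← pow_add, h]

theorem summable_and_tsum_eq (hq : ‖q‖ < 1) :
    Summable (fun n : ℕ+ =>
        qPoch (-q) q (n : ℕ) / qPoch q q (n : ℕ) * (q ^ (n : ℕ) / (1 - q ^ (n : ℕ)))) ∧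
      Summable (fun n : ℕ+ =>
        qPoch (-q) q ((n : ℕ) - 1) / qPoch q q (n : ℕ) ^ 2 *
          (q ^ ((n : ℕ) * ((n : ℕ) + 3) / 2) / (1 - q ^ (n : ℕ)))) ∧
      Summable (fun n : ℕ+ => q ^ (n : ℕ) / (1 - q ^ (n : ℕ))) ∧
      (∑' n : ℕ+,
          qPoch (-q) q (n : ℕ) / qPoch q q (n : ℕ) * (q ^ (n : ℕ) / (1 - q ^ (n : ℕ)))) -
        2 * (∑' n : ℕ+,
          qPoch (-q) q ((n : ℕ) - 1) / qPoch q q (n : ℕ) ^ 2 *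
            (q ^ ((n : ℕ) * ((n : ℕ) + 3) / 2) / (1 - q ^ (n : ℕ)))) =
      ∑' n : ℕ+, q ^ (n : ℕ) / (1 - q ^ (n : ℕ)) := by
  rw [summable_pnat_iff_summable_succ (f := fun n =>
      qPoch (-q) q n / qPoch q q n * (q ^ n / (1 - q ^ n))),
    summable_pnat_iff_summable_succ (f := fun n =>
      qPoch (-q) q (n - 1) / qPoch q q n ^ 2 * (q ^ (n * (n + 3) / 2) / (1 - q ^ n))),
    summable_pnat_iff_summable_succ (f := fun n => q ^ n / (1 - q ^ n)),
    tsum_pnat_eq_tsum_succ (f := fun n =>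
      qPoch (-q) q n / qPoch q q n * (q ^ n / (1 - q ^ n))),
    tsum_pnat_eq_tsum_succ (f := fun n =>
      qPoch (-q) q (n - 1) / qPoch q q n ^ 2 * (q ^ (n * (n + 3) / 2) / (1 - q ^ n))),
    tsum_pnat_eq_tsum_succ (f := fun n => q ^ n / (1 - q ^ n))]
  have hqq (n : ℕ) : (qPoch q q n)⁻¹ = ∏ i ∈ Finset.range n, (1 - q ^ (i + 1))⁻¹ := by
    rw [qPoch, ← Finset.prod_inv_distrib]
    exact Finset.prod_congr rfl fun i _ => by rw [pow_succ']
  have hA (n : ℕ) : qPoch (-q) q (n + 1) / qPoch q q (n + 1) *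
      (q ^ (n + 1) / (1 - q ^ (n + 1))) = (∏ i ∈ Finset.range (n + 1), (1 - -q * q ^ i)) *
      (∏ i ∈ Finset.range (n + 1), (1 - q ^ (i + 1))⁻¹) *
      (q ^ (n + 1) * (1 - q ^ (n + 1))⁻¹) := by
    rw [div_eq_mul_inv, div_eq_mul_inv, hqq, qPoch]
  have hB (n : ℕ) : qPoch (-q) q (n + 1 - 1) / qPoch q q (n + 1) ^ 2 *
      (q ^ ((n + 1) * (n + 1 + 3) / 2) / (1 - q ^ (n + 1))) =
      2⁻¹ * ((∏ i ∈ Finset.range (n + 1), (1 - q ^ (i + 1))⁻¹) *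
      (q ^ (n + 1) * (1 - q ^ (n + 1))⁻¹ *
        vandermondeCoeff q (-q) (fun i => (1 - q ^ i)⁻¹) (n + 1))) := by
    have h : qPoch (-q) q n = ∏ i ∈ Finset.range n, (1 + q ^ (i + 1)) :=
      Finset.prod_congr rfl fun i _ => by ring
    rw [vandermondeCoeff_neg_self_succ, ← prod_range_pow_mul_pow, Nat.add_sub_cancel, h,
      div_eq_mul_inv, div_eq_mul_inv, ← inv_pow, hqq]
    ring
  have hD (n : ℕ) : q ^ (n + 1) / (1 - q ^ (n + 1)) = q ^ (n + 1) * (1 - q ^ (n + 1))⁻¹ :=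
    div_eq_mul_inv _ _
  rw [funext hA, funext hB, funext hD]
  refine ⟨summable_qPochhammer_ratio hq _,
    (summable_prod_inv_mul_vandermondeCoeff hq _).mul_left _,
    summable_pow_mul_inv_one_sub_pow hq, ?_⟩
  rw [tsum_mul_left, tsum_qPochhammer_ratio_eq hq]
  ring

end Analysis

/-! ### Generating functions of weighted partitions -/

section PartitionSeries

open PowerSeries

/-- The power series `∑ⱼ w j X ^ (i j)`, for `i ≥ 1`: it counts the parts equal to `i`, a
multiplicity `j` having weight `w j`. -/
noncomputable def multSeries (i : ℕ) (w : ℕ → ℤ) : ℤ⟦X⟧ :=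
  PowerSeries.mk fun n => if i ∣ n then w (n / i) else 0

lemma multSeries_add (i : ℕ) (w w' : ℕ → ℤ) :
    multSeries i (fun j => w j + w' j) = multSeries i w + multSeries i w' := by
  ext n
  simp only [multSeries, coeff_mk, map_add]
  split_ifs <;> simp

lemma X_pow_mul_multSeries {i : ℕ} (hi : i ≠ 0) (w : ℕ → ℤ) :
    X ^ i * multSeries i w = multSeries i fun j => if j = 0 then 0 else w (j - 1) := by
  ext n
  simp only [multSeries, coeff_X_pow_mul', coeff_mk]
  rcases lt_or_ge n i with h | h
  · rw [if_neg h.not_ge, Nat.div_eq_of_lt h]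
    simp
  · obtain ⟨m, rfl⟩ := Nat.exists_eq_add_of_le h
    simp [Nat.pos_of_ne_zero hi]

/-- Multiplication by `1 - X ^ i` takes differences of the weights. -/
lemma one_sub_X_pow_mul_multSeries {i : ℕ} (hi : i ≠ 0) (w w' : ℕ → ℤ) (h0 : w 0 = w' 0)
    (h : ∀ j, w (j + 1) = w j + w' (j + 1)) :
    (1 - X ^ i) * multSeries i w = multSeries i w' := by
  have : multSeries i w = X ^ i * multSeries i w + multSeries i w' := by
    rw [X_pow_mul_multSeries hi, ← multSeries_add]
    congr 1
    ext j
    cases j <;> simp [h0, h]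
  linear_combination this

/-- The series `(1 - X ^ i)⁻¹`, for `i ≥ 1`. -/
noncomputable def geomSeries (i : ℕ) : ℤ⟦X⟧ := multSeries i fun _ => 1

lemma one_sub_X_pow_mul_geomSeries {i : ℕ} (hi : i ≠ 0) :
    (1 - X ^ i) * geomSeries i = 1 := by
  rw [geomSeries, one_sub_X_pow_mul_multSeries hi _ (fun j => if j = 0 then 1 else 0)
    (by simp) (by simp)]
  ext n
  simp only [multSeries, coeff_mk, coeff_one, Nat.div_eq_zero_iff, hi, false_or]
  rcases eq_or_ne n 0 with rfl | hn
  · simp [Nat.pos_of_ne_zero hi]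
  · rw [if_neg hn]
    split_ifs with h1 h2
    · exact absurd (Nat.le_of_dvd (Nat.pos_of_ne_zero hn) h1) h2.not_ge
    · rfl
    · rfl

lemma X_pow_mul_geomSeries {i : ℕ} (hi : i ≠ 0) :
    X ^ i * geomSeries i = multSeries i fun j => if j = 0 then 0 else 1 :=
  X_pow_mul_multSeries hi _

lemma geomSeries_sq {i : ℕ} (hi : i ≠ 0) :
    geomSeries i ^ 2 = multSeries i fun j => (j : ℤ) + 1 := by
  have h := one_sub_X_pow_mul_multSeries hi (fun j => (j : ℤ) + 1) (fun _ => 1) (by simp)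
    (fun j => by push_cast; ring)
  rw [← geomSeries] at h
  linear_combination multSeries i (fun j => (j : ℤ) + 1) * one_sub_X_pow_mul_geomSeries hi
    - geomSeries i * h

lemma two_mul_geomSeries_pow_three {i : ℕ} (hi : i ≠ 0) :
    2 * geomSeries i ^ 3 = multSeries i fun j => ((j : ℤ) + 1) * (j + 2) := by
  have h := one_sub_X_pow_mul_multSeries hi (fun j => ((j : ℤ) + 1) * (j + 2))
    (fun j => ((j : ℤ) + 1) + (j + 1)) (by simp) (fun j => by push_cast; ring)
  rw [multSeries_add, ← geomSeries_sq hi] at h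
  linear_combination multSeries i (fun j => ((j : ℤ) + 1) * (j + 2)) *
    one_sub_X_pow_mul_geomSeries hi - geomSeries i * h

/-- The weight of a part size that occurs `c` times when its first occurrence may be overlined. -/
def overlineWeight (c : ℕ) : ℤ := if c = 0 then 1 else 2

/-- The weight `2 c - 1` of a part size that has to occur, and occurs `c` times. -/
def oddWeight (c : ℕ) : ℤ := if c = 0 then 0 else 2 * c - 1

lemma multSeries_overlineWeight {i : ℕ} (hi : i ≠ 0) :
    multSeries i overlineWeight = (1 + X ^ i) * geomSeries i := by
  rw [add_mul, one_mul, X_pow_mul_geomSeries hi, geomSeries, ← multSeries_add]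
  congr 1
  ext j
  cases j <;> simp [overlineWeight]

lemma multSeries_oddWeight {i : ℕ} (hi : i ≠ 0) :
    multSeries i oddWeight = X ^ i * (1 + X ^ i) * geomSeries i ^ 2 := by
  rw [mul_assoc, add_mul, one_mul, geomSeries_sq hi, mul_add, X_pow_mul_multSeries hi,
    X_pow_mul_multSeries hi, ← multSeries_add]
  congr 1
  ext j
  rcases j with _ | _ | j
  · simp [oddWeight]
  · simp [oddWeight]
  · simp [oddWeight]; ring

lemma multSeries_mul_sub_one {i : ℕ} (hi : i ≠ 0) :
    multSeries i (fun j => (j : ℤ) * (j - 1)) = 2 * X ^ (2 * i) * geomSeries i ^ 3 := by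
  have h : 2 * X ^ (2 * i) * geomSeries i ^ 3 = X ^ i * (X ^ i * (2 * geomSeries i ^ 3)) := by
    ring
  rw [h, two_mul_geomSeries_pow_three hi, X_pow_mul_multSeries hi, X_pow_mul_multSeries hi]
  congr 1
  ext j
  rcases j with _ | _ | j
  · simp
  · simp
  · simp; ring

/-- The generating function of partitions into parts from `s`, weighted by multiplicities. Unlike
in `Nat.Partition.genFun`, a part size from `s` that does not occur may have a weight other
than `1`. -/
theorem coeff_prod_multSeries (w : ℕ → ℕ → ℤ) {s : Finset ℕ} (hs : 0 ∉ s) (n : ℕ) :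
    coeff n (∏ i ∈ s, multSeries i (w i)) =
      ∑ π : n.Partition with ∀ p ∈ π.parts, p ∈ s, ∏ i ∈ s, w i (mult π i) := by
  rw [coeff_prod]
  have hdvd (g : ℕ →₀ ℕ) (hg : ∏ i ∈ s, coeff (g i) (multSeries i (w i)) ≠ 0) (i : ℕ)
      (hi : i ∈ s) : i ∣ g i := by
    by_contra h
    exact Finset.prod_ne_zero_iff.mp hg i hi (by simp [multSeries, h])
  -- A multiplicity function `i ↦ c i` corresponds to the point `i ↦ i * c i` of the antidiagonal;
  -- the points with `¬ i ∣ g i` for some `i` contribute zero.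
  refine (Finset.sum_of_injOn Nat.Partition.toFinsuppAntidiag
    (Nat.Partition.toFinsuppAntidiag_injective n).injOn ?_ ?_ ?_).symm
  · intro π hπ
    simp only [Finset.coe_filter, Finset.mem_univ, true_and, Set.mem_ofPred_eq] at hπ
    have h := π.toFinsuppAntidiag_mem_finsuppAntidiag
    rw [Finset.mem_finsuppAntidiag'] at h
    rw [SetLike.mem_coe, Finset.mem_finsuppAntidiag']
    refine ⟨h.1, fun i hi => hπ i ?_⟩
    simpa [Nat.Partition.toFinsuppAntidiag] using hi
  · intro g hg hg'
    by_contra hne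
    obtain ⟨h1, h2⟩ := Finset.mem_finsuppAntidiag.mp hg
    have hd := hdvd g hne
    have hsupp (i : ℕ) (hi : g i ≠ 0) : i ∈ s := h2 (by simpa using hi)
    refine hg' ⟨Nat.Partition.mk (Finsupp.mk g.support (fun i => g i / i) ?_).toMultiset ?_ ?_,
      ?_, ?_⟩
    · intro i
      rw [Finsupp.mem_support_iff]
      refine ⟨fun hi h => hi ?_, fun hi h => hi (by simp [h])⟩
      rw [← Nat.div_mul_cancel (hd i (hsupp i hi)), h, zero_mul]
    · suffices ∀ i, g i ≠ 0 → i ≠ 0 by simpa [Nat.pos_iff_ne_zero]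
      rintro i hi rfl
      exact hs (hsupp 0 hi)
    · refine Eq.trans ?_ h1
      suffices ∑ i ∈ g.support, g i / i * i = ∑ i ∈ s, g i by simpa [Finsupp.sum]
      apply Finset.sum_subset_zero_on_sdiff h2 (by simp)
      exact fun i hi => Nat.div_mul_cancel (hd i (h2 hi))
    · simpa using hsupp
    · ext i
      by_cases hi : i ∈ s
      · simpa [Nat.Partition.toFinsuppAntidiag] using Nat.div_mul_cancel (hd i hi)
      · have : g i = 0 := by_contra fun h => hi (hsupp i h)
        simp [Nat.Partition.toFinsuppAntidiag, this]
  · intro π _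
    refine Finset.prod_congr rfl fun i hi => ?_
    have hi0 : 0 < i := Nat.pos_of_ne_zero fun h => hs (h ▸ hi)
    simp [multSeries, Nat.Partition.toFinsuppAntidiag, mult, hi0]

lemma largestPart_mem {n : ℕ} (hn : 1 ≤ n) (π : n.Partition) : largestPart π ∈ π.parts := by
  have hne : π.parts.toFinset.Nonempty := by
    rw [Multiset.toFinset_nonempty]
    intro h
    have := π.parts_sum
    rw [h, Multiset.sum_zero] at this
    omega
  obtain ⟨m, hm, hmax⟩ := Finset.exists_max_image π.parts.toFinset id hne
  rw [Multiset.mem_toFinset] at hm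
  have h : largestPart π = m :=
    le_antisymm (Multiset.sup_le.mpr fun p hp => hmax p (Multiset.mem_toFinset.mpr hp))
      (Multiset.le_sup hm)
  rwa [h]

lemma le_largestPart {n : ℕ} {π : n.Partition} {p : ℕ} (hp : p ∈ π.parts) :
    p ≤ largestPart π :=
  Multiset.le_sup hp

/-- Partitions sorted by their largest part `m + 1`: a multiplicity `c` of a smaller size has
weight `w c`, also for `c = 0`, and the multiplicity of the largest part has weight `v`. -/
theorem sum_coeff_prod_multSeries_mul (w v : ℕ → ℤ) (hv : v 0 = 0) {n : ℕ} (hn : 1 ≤ n) :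
    ∑ m ∈ Finset.range n,
      coeff n ((∏ i ∈ Finset.range m, multSeries (i + 1) w) * multSeries (m + 1) v) =
    ∑ π : n.Partition, v (largestMult π) *
      ∏ i ∈ Finset.Icc 1 (largestPart π - 1), w (mult π i) := by
  have hIcc (m : ℕ) : Finset.Icc 1 (m + 1) = insert (m + 1) (Finset.Icc 1 m) := by
    ext i
    simp only [Finset.mem_Icc, Finset.mem_insert]
    omega
  have hsplit {M : Type} [CommMonoid M] (m : ℕ) (f g : ℕ → M) :
      ∏ i ∈ Finset.Icc 1 (m + 1), (if i = m + 1 then g i else f i) =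
        (∏ i ∈ Finset.Icc 1 m, f i) * g (m + 1) := by
    rw [hIcc, Finset.prod_insert (by simp), if_pos rfl, mul_comm]
    congr 1
    refine Finset.prod_congr rfl fun i hi => if_neg ?_
    have := Finset.mem_Icc.mp hi
    omega
  have hterm (m : ℕ) :
      coeff n ((∏ i ∈ Finset.range m, multSeries (i + 1) w) * multSeries (m + 1) v) =
      ∑ π : n.Partition, if ∀ p ∈ π.parts, p ∈ Finset.Icc 1 (m + 1) then
        (∏ i ∈ Finset.Icc 1 m, w (mult π i)) * v (mult π (m + 1)) else 0 := by
    have h := coeff_prod_multSeries (fun i c => if i = m + 1 then v c else w c)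
      (s := Finset.Icc 1 (m + 1)) (by simp) n
    rw [Finset.sum_filter] at h
    simp only [hsplit m (fun i => w (mult _ i)) (fun i => v (mult _ i))] at h
    have hshift : ∏ i ∈ Finset.range m, multSeries (i + 1) w =
        ∏ i ∈ Finset.Icc 1 m, multSeries i w := by
      have h := Finset.prod_Ico_eq_prod_range (fun i => multSeries i w) 1 (m + 1)
      simp only [Nat.add_sub_cancel, add_comm 1] at h
      exact h.symm
    rw [← h, hshift, ← hsplit m (fun i => multSeries i w) (fun i => multSeries i v)]
    congr 1
    refine Finset.prod_congr rfl fun i _ => ?_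
    split_ifs <;> rfl
  rw [Finset.sum_congr rfl fun m _ => hterm m, Finset.sum_comm]
  refine Finset.sum_congr rfl fun π _ => ?_
  have hmem := largestPart_mem hn π
  have hpos := π.parts_pos hmem
  have hle := π.le_of_mem_parts hmem
  rw [Finset.sum_eq_single (largestPart π - 1)]
  · rw [Nat.sub_add_cancel hpos, if_pos, mul_comm, largestMult]
    exact fun p hp => Finset.mem_Icc.mpr ⟨π.parts_pos hp, le_largestPart hp⟩
  · intro m _ hm
    split_ifs with h
    · have h1 := (Finset.mem_Icc.mp (h _ hmem)).2
      have h2 : mult π (m + 1) = 0 := Multiset.count_eq_zero.mpr fun hp => by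
        have := le_largestPart hp
        omega
      rw [h2, hv, mul_zero]
    · rfl
  · intro h
    exact absurd (Finset.mem_range.mpr (by omega)) h

/-! ### The finite identity in `ℤ⟦X⟧` -/

/-- In the ring `ℤ⟦X⟧`, the numerator of the Gaussian binomial `[n, k + 1]` is `1` up to order
`n - k`. -/
lemma X_pow_dvd_prod_one_sub_sub_one {n k : ℕ} (hk : k < n) :
    (X : ℤ⟦X⟧) ^ (n - k) ∣ ∏ i ∈ Finset.range (k + 1), (1 - X ^ (n - i)) - 1 := by
  have h : ∀ j ≤ k + 1,
      (X : ℤ⟦X⟧) ^ (n - k) ∣ ∏ i ∈ Finset.range j, (1 - X ^ (n - i)) - 1 := by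
    intro j
    induction j with
    | zero => simp
    | succ j ih =>
      intro hj
      have h1 : (X : ℤ⟦X⟧) ^ (n - k) ∣ X ^ (n - j) := pow_dvd_pow _ (by omega)
      have h2 : ∏ i ∈ Finset.range (j + 1), (1 - (X : ℤ⟦X⟧) ^ (n - i)) - 1 =
          (∏ i ∈ Finset.range j, (1 - X ^ (n - i)) - 1) -
            (∏ i ∈ Finset.range j, (1 - X ^ (n - i))) * X ^ (n - j) := by
        rw [Finset.prod_range_succ]
        ring
      rw [h2]
      exact dvd_sub (ih (by omega)) (h1.mul_left _)
  exact h (k + 1) le_rfl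

/-- Below the order at which they differ, `[n, k + 1]` may be replaced by its limit
`1 / (X; X)_{k+1}`. -/
lemma coeff_gaussBinom_mul {n k : ℕ} (hk : k < n) {F : ℤ⟦X⟧} (hF : X ^ (k + 1) ∣ F) :
    coeff n (gaussBinom X n (k + 1) * F) =
      coeff n ((∏ i ∈ Finset.range (k + 1), geomSeries (i + 1)) * F) := by
  rw [gaussBinom_eq_prod_mul (u := geomSeries)
    (fun i => one_sub_X_pow_mul_geomSeries i.succ_ne_zero), ← sub_eq_zero, ← map_sub]
  have h := mul_dvd_mul (X_pow_dvd_prod_one_sub_sub_one hk)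
    (hF.mul_left (∏ i ∈ Finset.range (k + 1), geomSeries (i + 1)))
  rw [← pow_add, show n - k + (k + 1) = n + 1 by omega] at h
  refine (X_pow_dvd_iff (n := n + 1)).mp ?_ n n.lt_succ_self
  convert h using 1
  ring

lemma sum_coeff_X_pow_mul_geomSeries {n : ℕ} (hn : 1 ≤ n) :
    ∑ m ∈ Finset.range n, coeff n ((X : ℤ⟦X⟧) ^ (m + 1) * geomSeries (m + 1)) = n.divisors.card := by
  have h (m : ℕ) : coeff n (X ^ (m + 1) * geomSeries (m + 1)) =
      if m + 1 ∣ n then (1 : ℤ) else 0 := by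
    rw [X_pow_mul_geomSeries m.succ_ne_zero, multSeries, coeff_mk]
    split_ifs with h1 h2
    · exact absurd (Nat.eq_zero_of_dvd_of_div_eq_zero h1 h2) (by omega)
    · rfl
    · rfl
  rw [Finset.sum_congr rfl fun m _ => h m, Nat.divisors, Finset.card_filter, Nat.cast_sum,
    Finset.sum_Ico_eq_sum_range]
  refine Finset.sum_congr (by simp) fun m _ => ?_
  rw [add_comm 1 m]
  split_ifs <;> simp

/-- The coefficient of `X ^ n` in the finite identity with `N = n`, `q = X` and `b = -X`. -/
theorem sum_oddWeight_sub_sum_eq_card_divisors {n : ℕ} (hn : 1 ≤ n) :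
    (∑ π : n.Partition, oddWeight (largestMult π) *
      ∏ i ∈ Finset.Icc 1 (largestPart π - 1), overlineWeight (mult π i)) -
    (∑ π : n.Partition, (largestMult π : ℤ) * (largestMult π - 1) *
      ∏ i ∈ Finset.Icc 1 (largestPart π - 1), oddWeight (mult π i)) = n.divisors.card := by
  rw [← sum_coeff_prod_multSeries_mul overlineWeight oddWeight (by simp [oddWeight]) hn,
    ← sum_coeff_prod_multSeries_mul oddWeight (fun c => (c : ℤ) * (c - 1)) (by simp) hn,
    ← sum_coeff_X_pow_mul_geomSeries hn, sub_eq_iff_eq_add]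
  have h := congrArg (coeff n) (sum_qPochhammer_ratio_eq (-X : ℤ⟦X⟧) (u := geomSeries)
    (fun i => one_sub_X_pow_mul_geomSeries i.succ_ne_zero) n)
  rw [map_add, map_sum, map_sum, map_sum] at h
  refine Eq.trans (Finset.sum_congr rfl fun m _ => ?_)
    (h.trans (congrArg₂ (· + ·) rfl (Finset.sum_congr rfl fun k hk => ?_)))
  · congr 1
    have hprod : ∏ i ∈ Finset.range m, multSeries (i + 1) overlineWeight =
        (∏ i ∈ Finset.range m, (1 + X ^ (i + 1))) *
          ∏ i ∈ Finset.range m, geomSeries (i + 1) := by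
      rw [← Finset.prod_mul_distrib]
      exact Finset.prod_congr rfl fun i _ => multSeries_overlineWeight i.succ_ne_zero
    have hneg : ∏ i ∈ Finset.range (m + 1), (1 - -X * X ^ i : ℤ⟦X⟧) =
        ∏ i ∈ Finset.range (m + 1), (1 + X ^ (i + 1)) :=
      Finset.prod_congr rfl fun i _ => by ring
    rw [hprod, hneg, multSeries_oddWeight m.add_one_ne_zero, Finset.prod_range_succ _ m,
      Finset.prod_range_succ _ m]
    ring
  · rw [coeff_gaussBinom_mul (Finset.mem_range.mp hk)
      (by rw [mul_assoc]; exact Dvd.intro _ rfl)]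
    congr 1
    have hprod : ∏ i ∈ Finset.range k, multSeries (i + 1) oddWeight =
        (∏ i ∈ Finset.range k, X ^ (i + 1)) * (∏ i ∈ Finset.range k, (1 + X ^ (i + 1))) *
          (∏ i ∈ Finset.range k, geomSeries (i + 1)) ^ 2 := by
      rw [← Finset.prod_pow, ← Finset.prod_mul_distrib, ← Finset.prod_mul_distrib]
      exact Finset.prod_congr rfl fun i _ => multSeries_oddWeight i.succ_ne_zero
    rw [hprod, multSeries_mul_sub_one k.add_one_ne_zero, vandermondeCoeff_neg_self_succ,
      Finset.prod_range_succ' (fun i => (X : ℤ⟦X⟧) ^ i), pow_zero,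
      Finset.prod_range_succ (fun i => geomSeries (i + 1)) k]
    ring

/-! ### Overpartitions and partitions without gaps -/

/-- Overlining the largest part and any of the smaller part sizes: summation over the sets of
overlined sizes. -/
lemma sum_overpartition_eq {n : ℕ} (hn : 1 ≤ n) (f : n.Partition → ℤ) :
    ∑ π : Overpartition n with largestPart π.partition ∈ π.overlined, f π.partition =
      ∑ π : n.Partition, f π *
        ∏ i ∈ Finset.Icc 1 (largestPart π - 1), overlineWeight (mult π i) := by
  rw [Finset.sum_filter, ← (overpartitionEquiv n).sum_comp, Fintype.sum_sigma]
  refine Finset.sum_congr rfl fun π _ => ?_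
  have hmem := largestPart_mem hn π
  have hpos := π.parts_pos hmem
  have hprod : ∏ i ∈ Finset.Icc 1 (largestPart π - 1), overlineWeight (mult π i) =
      2 ^ (π.parts.toFinset.erase (largestPart π)).card := by
    simp only [overlineWeight]
    rw [Finset.prod_ite, Finset.prod_const_one, one_mul, Finset.prod_const]
    congr 2
    ext i
    simp only [mult, Finset.mem_filter, Finset.mem_Icc, Finset.mem_erase, Multiset.mem_toFinset,
      Multiset.count_eq_zero, not_not]
    constructor
    · rintro ⟨h1, h2⟩
      exact ⟨by omega, h2⟩
    · rintro ⟨h1, h2⟩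
      have h3 := le_largestPart h2
      have h4 := π.parts_pos h2
      exact ⟨by omega, h2⟩
  rw [hprod]
  have hsum : ∑ S ∈ π.parts.toFinset.powerset, (if largestPart π ∈ S then f π else 0) =
      f π * 2 ^ (π.parts.toFinset.erase (largestPart π)).card := by
    conv_lhs => rw [← Finset.insert_erase (Multiset.mem_toFinset.mpr hmem)]
    rw [Finset.sum_powerset_insert (Finset.notMem_erase _ _),
      Finset.sum_eq_zero fun S hS => if_neg fun h =>
        Finset.notMem_erase _ _ (Finset.mem_powerset.mp hS h),
      Finset.sum_congr rfl fun S _ => if_pos (Finset.mem_insert_self _ _), zero_add,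
      Finset.sum_const, Finset.card_powerset, nsmul_eq_mul, mul_comm]
    norm_num
  rw [← hsum]
  exact Finset.sum_coe_sort π.parts.toFinset.powerset
    fun S => if largestPart π ∈ S then f π else 0

theorem sum_overpartition_sub_sum_gapFree {n : ℕ} (hn : 1 ≤ n) :
    (∑ π : Overpartition n with largestPart π.partition ∈ π.overlined,
          (2 * (largestMult π.partition : ℤ) - 1)) -
        (∑ π : n.Partition with GapFree π ∧ 2 ≤ largestMult π,
          (largestMult π : ℤ) * ((largestMult π : ℤ) - 1) *
            ∏ i ∈ Finset.Icc 1 (largestPart π - 1), (2 * (mult π i : ℤ) - 1)) =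
      (n.divisors.card : ℤ) := by
  have hL (π : n.Partition) : 1 ≤ largestMult π :=
    Multiset.one_le_count_iff_mem.mpr (largestPart_mem hn π)
  rw [← sum_oddWeight_sub_sum_eq_card_divisors hn,
    sum_overpartition_eq hn fun π => 2 * (largestMult π : ℤ) - 1, Finset.sum_filter]
  congr 1
  · refine Finset.sum_congr rfl fun π _ => ?_
    rw [oddWeight, if_neg (by have := hL π; omega)]
  · refine Finset.sum_congr rfl fun π _ => ?_
    split_ifs with h
    · congr 1
      refine Finset.prod_congr rfl fun i hi => ?_
      have hi' := Finset.mem_Icc.mp hi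
      rw [oddWeight, if_neg]
      exact (Multiset.count_pos.mpr (h.1 i (Finset.mem_Icc.mpr ⟨hi'.1, by omega⟩))).ne'
    -- Otherwise a missing part size gives a factor `oddWeight 0 = 0`, or `L * (L - 1) = 0`.
    · rw [not_and_or] at h
      rcases h with h | h
      · rw [GapFree] at h
        push Not at h
        obtain ⟨i, hi, hi2⟩ := h
        have hi' := Finset.mem_Icc.mp hi
        have hne : i ≠ largestPart π := fun h => hi2 (h ▸ largestPart_mem hn π)
        rw [Finset.prod_eq_zero (i := i) (Finset.mem_Icc.mpr ⟨hi'.1, by omega⟩), mul_zero]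
        exact if_pos (Multiset.count_eq_zero.mpr hi2)
      · rw [show largestMult π = 1 by have := hL π; omega]
        simp

end PartitionSeries

end QDivisor

open QDivisor in
theorem corollary2p13 :
    (∀ q : ℂ, ‖q‖ < 1 →
      Summable (fun n : ℕ+ =>
        qPoch (-q) q (n : ℕ) / qPoch q q (n : ℕ) * (q ^ (n : ℕ) / (1 - q ^ (n : ℕ)))) ∧
      Summable (fun n : ℕ+ =>
        qPoch (-q) q ((n : ℕ) - 1) / qPoch q q (n : ℕ) ^ 2 *
          (q ^ ((n : ℕ) * ((n : ℕ) + 3) / 2) / (1 - q ^ (n : ℕ)))) ∧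
      Summable (fun n : ℕ+ => q ^ (n : ℕ) / (1 - q ^ (n : ℕ))) ∧
      (∑' n : ℕ+,
          qPoch (-q) q (n : ℕ) / qPoch q q (n : ℕ) * (q ^ (n : ℕ) / (1 - q ^ (n : ℕ)))) -
        2 * (∑' n : ℕ+,
          qPoch (-q) q ((n : ℕ) - 1) / qPoch q q (n : ℕ) ^ 2 *
            (q ^ ((n : ℕ) * ((n : ℕ) + 3) / 2) / (1 - q ^ (n : ℕ)))) =
      ∑' n : ℕ+, q ^ (n : ℕ) / (1 - q ^ (n : ℕ))) ∧
    (∀ n : ℕ, 1 ≤ n →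
      (∑ π : Overpartition n with largestPart π.partition ∈ π.overlined,
          (2 * (largestMult π.partition : ℤ) - 1)) -
        (∑ π : n.Partition with GapFree π ∧ 2 ≤ largestMult π,
          (largestMult π : ℤ) * ((largestMult π : ℤ) - 1) *
            ∏ i ∈ Finset.Icc 1 (largestPart π - 1), (2 * (mult π i : ℤ) - 1)) =
      (n.divisors.card : ℤ)) := by
  exact ⟨fun _ hq => summable_and_tsum_eq hq, fun _ hn => sum_overpartition_sub_sum_gapFree hn⟩
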